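/- Let $A$ be a finite lattice algebra, i.e. a finite lattice $(A,\wedge,\vee)$ possibly equipped with additional finitary operations, and let $\tau$ be a finite vocabulary of relation symbols, each $R\in\tau$ having an arity $\tau(R)\ge 1$. The formulas of the $A$-valued predicate logic $\mathcal L^A(\tau)$ are built from the atomic formulas $R(x_{i_1},\dots,x_{i_{\tau(R)}})$, $R\in\tau$ (there is no identity symbol), by connectives corresponding to all operations of $A$ (including $\wedge,\vee$) and by the quantifiers $\forall,\exists$; a sentence is a formula without free variables. An $A$-valued $\tau$-structure $\mathfrak M$ with domain $[n]=\{1,\dots,n\}$, $n\ge 1$, consists of a map $R^{\mathfrak M}:[n]^{\tau(R)}\to A$ for each $R\in\tau$. The truth value $\|\varphi\|^{\mathfrak M}\in A$ of a sentence $\varphi$ is defined recursively, by interpreting atomic formulas according to $\mathfrak M$, connectives by the operations of $A$, and $\forall$, $\exists$ by infima and suprema in $A$ over the domain. For each $R\in\tau$ fix a probability distribution $p_R$ on $A$ with $p_R(a)>0$ for all $a\in A$. Let $$\Pr\nolimits_n(\mathfrak M)=\prod_{R\in\tau}\ \prod_{(i_1,\dots,i_{\tau(R)})\in[n]^{\tau(R)}}p_R\bigl(R^{\mathfrak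 M}(i_1,\dots,i_{\tau(R)})\bigr),\qquad \mu_n(\varphi=a)=\sum_{\mathfrak M:\ \|\varphi\|^{\mathfrak M}=a}\Pr\nolimits_n(\mathfrak M),$$ where $\mathfrak M$ ranges over the $A$-valued $\tau$-structures with domain $[n]$. Then for every sentence $\varphi\in\mathcal L^A(\tau)$ and every $a\in A$, $\lim_{n\to\infty}\mu_n(\varphi=a)=1$ or $\lim_{n\to\infty}\mu_n(\varphi=a)=0$. Equivalently, for every sentence $\varphi\in\mathcal L^A(\tau)$ there is a unique $a\in A$ such that $\lim_{n\to\infty}\mu_n(\varphi=a)=1$. -/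

import Mathlib

open Filter Topology

namespace ManyValued

universe u v w x

/-- A family of symbols with finite arities. It serves both as a relational vocabulary
(predicate symbols) and as the list of the connectives that a lattice algebra may have besides
meet and join (operation symbols; arity `0` then gives truth constants). -/
structure Vocabulary where
  /-- the symbols -/
  Symb : Type u
  /-- the arity of each symbol -/
  arity : Symb → ℕ

/-- The additional operations of a lattice algebra with carrier `A`: an arbitrary interpretation
of the operation symbols in `σ`. Together with `[Lattice A]` this is a lattice algebra. -/
abbrev Operations (σ : Vocabulary.{u}) (A : Type v) : Type (max u v) :=
  (c : σ.Symb) → (Fin (σ.arity c) → A) → A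

/-- Formulas `φ(x₀, …, x_{k-1})` of the first-order predicate logic over the relational
vocabulary `τ` with connectives `∧`, `∨` and those of `σ`, having their free variables among
`x₀, …, x_{k-1}`. The quantifiers bind the variable with the last index. There is no identity
symbol. -/
inductive Formula (σ : Vocabulary.{u}) (τ : Vocabulary.{v}) : ℕ → Type (max u v)
  | rel {k : ℕ} (R : τ.Symb) (xs : Fin (τ.arity R) → Fin k) : Formula σ τ k
  | and {k : ℕ} (φ ψ : Formula σ τ k) : Formula σ τ k
  | or {k : ℕ} (φ ψ : Formula σ τ k) : Formula σ τ k
  | conn {k : ℕ} (c : σ.Symb) (φs : Fin (σ.arity c) → Formula σ τ k) : Formula σ τ k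
  | all {k : ℕ} (φ : Formula σ τ (k + 1)) : Formula σ τ k
  | ex {k : ℕ} (φ : Formula σ τ (k + 1)) : Formula σ τ k

/-- Sentences: formulas without free variables. -/
abbrev Sentence (σ : Vocabulary.{u}) (τ : Vocabulary.{v}) : Type (max u v) :=
  Formula σ τ 0

/-- `A`-valued `τ`-structures with domain `M`: a map `R^𝔐 : M^{τ(R)} → A` for each `R ∈ τ`. -/
abbrev Model (τ : Vocabulary.{u}) (A : Type v) (M : Type w) : Type (max u v w) :=
  (R : τ.Symb) → (Fin (τ.arity R) → M) → A

/-- The truth value `‖φ‖^𝔐(i₀, …, i_{k-1})` in a structure with finite nonempty domain.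
Connectives are interpreted by the algebra, `∀` and `∃` by infima and suprema over the domain. -/
def Formula.value {σ : Vocabulary.{u}} {τ : Vocabulary.{v}} {A : Type w} [Lattice A]
    (op : Operations σ A) {M : Type x} [Fintype M] [Nonempty M] (𝔐 : Model τ A M) :
    {k : ℕ} → Formula σ τ k → (Fin k → M) → A
  | _, .rel R xs, i => 𝔐 R (fun j => i (xs j))
  | _, .and φ ψ, i => φ.value op 𝔐 i ⊓ ψ.value op 𝔐 i
  | _, .or φ ψ, i => φ.value op 𝔐 i ⊔ ψ.value op 𝔐 i
  | _, .conn c φs, i => op c (fun j => (φs j).value op 𝔐 i)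
  | _, .all φ, i => Finset.univ.inf' Finset.univ_nonempty (fun m : M => φ.value op 𝔐 (Fin.snoc i m))
  | _, .ex φ, i => Finset.univ.sup' Finset.univ_nonempty (fun m : M => φ.value op 𝔐 (Fin.snoc i m))

/-- The probability of a structure when the values of the atomic statements
`R(i₁, …, i_{τ(R)})` are chosen independently with distributions `p R`. -/
noncomputable def modelProb {τ : Vocabulary.{u}} [Fintype τ.Symb] {A : Type v} {M : Type w}
    [Fintype M] (p : τ.Symb → A → ℝ) (𝔐 : Model τ A M) : ℝ :=
  open Classical in ∏ R : τ.Symb, ∏ i : Fin (τ.arity R) → M, p R (𝔐 R i)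

/-- The probability `μ(φ(i₀, …, i_{k-1}) = a)` that a random `A`-valued structure with domain
`M` gives the value `a` to `φ(i₀, …, i_{k-1})`. -/
noncomputable def valueProb {σ : Vocabulary.{u}} {τ : Vocabulary.{v}} [Fintype τ.Symb]
    {A : Type w} [Lattice A] [Fintype A] (op : Operations σ A) (p : τ.Symb → A → ℝ)
    {M : Type x} [Fintype M] [Nonempty M] {k : ℕ} (φ : Formula σ τ k) (i : Fin k → M) (a : A) : ℝ :=
  open Classical in ∑ 𝔐 : Model τ A M with φ.value op 𝔐 i = a, modelProb p 𝔐

/-- The sequence `μ_n(φ = a)` for a sentence `φ`, with domain `[n]` of size `n ≥ 1`; the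
argument `n` of this function stands for the domain of size `n + 1`. -/
noncomputable def sentenceProb {σ : Vocabulary.{u}} {τ : Vocabulary.{v}} [Fintype τ.Symb]
    {A : Type w} [Lattice A] [Fintype A] (op : Operations σ A) (p : τ.Symb → A → ℝ)
    (φ : Sentence σ τ) (a : A) (n : ℕ) : ℝ :=
  valueProb op p (M := Fin (n + 1)) φ Fin.elim0 a

end ManyValued

/-! This is Fagin's argument with extension properties. Over a fixed tuple of `k` distinct elements
and a fixed pattern of values of the new atoms, different candidate elements involve disjoint sets
of atoms. They fail independently, each with probability at most `1 - c ^ d`, where `c > 0` bounds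
all `p R a` from below and `d` counts the new atoms. There are only polynomially many tuples and a
fixed number of patterns, so `HasExtensions k` holds with probability tending to 1
(`eventProb_not_hasExtensions_le`).

The other half is deterministic. In structures with enough extensions, a back-and-forth induction
(`exists_determinedBelow`) shows that the value of a formula depends only on the atomic type of a
tuple: infima and suprema depend only on the set of values attained, and these sets agree. Tuples
with repetitions are written as `i ∘ g` with `i` injective. As no symbol is nullary, the empty tuple
has a single type, so a sentence has one value in all these structures. -/

namespace ManyValued

/-! ### Product weights -/

section Weights

variable {ι A : Type*} [Fintype ι] [DecidableEq ι] [Fintype A]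

open Classical in
/-- The total weight of the functions with prescribed values on an injectively indexed set of
coordinates. -/
theorem sum_prod_mul_prod_ite_eq (w : ι → A → ℝ) (hw : ∀ t, ∑ a, w t a = 1)
    {Q : Type*} (e : Q → ι) (he : Function.Injective e) (f : Q → A) (U : Finset Q) :
    ∑ x : ι → A, (∏ t, w t (x t)) * ∏ q ∈ U, (if x (e q) = f q then (1 : ℝ) else 0)
      = ∏ q ∈ U, w (e q) (f q) := by
  -- Each indicator is moved to the coordinate `e q` that it tests, so that the sum factors over
  -- coordinates; by injectivity at most one `q` meets each coordinate.
  have hx : ∀ x : ι → A,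
      (∏ t, w t (x t)) * ∏ q ∈ U, (if x (e q) = f q then (1 : ℝ) else 0)
        = ∏ t, (w t (x t) *
            ∏ q ∈ U, if e q = t then (if x t = f q then (1 : ℝ) else 0) else 1) := by
    intro x
    rw [Finset.prod_mul_distrib, Finset.prod_comm]
    simp
  have ht : ∀ t, (∑ a, w t a * ∏ q ∈ U, if e q = t then (if a = f q then (1 : ℝ) else 0) else 1)
      = ∏ q ∈ U, if e q = t then w t (f q) else 1 := by
    intro t
    by_cases h : ∃ q ∈ U, e q = t
    · obtain ⟨q, hq, rfl⟩ := h
      have hsingle : ∀ g : Q → ℝ, (∏ r ∈ U, if e r = e q then g r else 1) = g q := by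
        intro g
        rw [Finset.prod_eq_single_of_mem q hq fun r _ hr => if_neg (he.ne hr), if_pos rfl]
      simp only [hsingle]
      simp
    · have hone : ∀ g : Q → ℝ, (∏ r ∈ U, if e r = t then g r else 1) = 1 := fun g =>
        Finset.prod_eq_one fun r hr => if_neg fun hrt => h ⟨r, hr, hrt⟩
      simp only [hone, mul_one, hw]
  rw [Finset.sum_congr rfl fun x _ => hx x,
    ← Fintype.prod_sum fun t a => w t a *
      ∏ q ∈ U, if e q = t then (if a = f q then (1 : ℝ) else 0) else 1,
    Finset.prod_congr rfl fun t _ => ht t, Finset.prod_comm]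
  simp

open Classical in
/-- The total weight of the functions that deviate from a given pattern on each of a family of
disjoint blocks of coordinates. -/
theorem sum_prod_filter_forall_exists_ne (w : ι → A → ℝ) (hw : ∀ t, ∑ a, w t a = 1)
    {S D : Type*} [Fintype S] [Fintype D] (e : S × D → ι) (he : Function.Injective e)
    (f : D → A) (P : (ι → A) → Prop) {_ : DecidablePred P}
    (hP : ∀ x, P x ↔ ∀ s, ∃ d, x (e (s, d)) ≠ f d) :
    ∑ x : ι → A with P x, ∏ t, w t (x t)
      = ∏ s, (1 - ∏ d, w (e (s, d)) (f d)) := by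
  have hind : ∀ x : ι → A, (if P x then ∏ t, w t (x t) else 0)
      = (∏ t, w t (x t)) * ∏ s, (1 - ∏ d, if x (e (s, d)) = f d then (1 : ℝ) else 0) := by
    intro x
    split_ifs with h
    · rw [Finset.prod_eq_one (s := Finset.univ (α := S)), mul_one]
      intro s _
      obtain ⟨d, hd⟩ := (hP x).1 h s
      rw [Finset.prod_eq_zero (Finset.mem_univ d) (if_neg hd), sub_zero]
    · rw [hP] at h
      push Not at h
      obtain ⟨s, hs⟩ := h
      rw [Finset.prod_eq_zero (Finset.mem_univ s), mul_zero]
      rw [Finset.prod_eq_one fun d _ => if_pos (hs d), sub_self]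
  -- Inclusion–exclusion over the set `U` of blocks that match the pattern; the same expansion, read
  -- backwards, yields the product on the right-hand side.
  have hexp : ∀ x : ι → A,
      (∏ t, w t (x t)) * ∏ s, (1 - ∏ d, if x (e (s, d)) = f d then (1 : ℝ) else 0)
        = ∑ U ∈ (Finset.univ : Finset S).powerset, (-1) ^ U.card * ((∏ t, w t (x t)) *
            ∏ q ∈ U ×ˢ Finset.univ, if x (e q) = f q.2 then (1 : ℝ) else 0) := by
    intro x
    rw [Finset.prod_sub, Finset.mul_sum]
    refine Finset.sum_congr rfl fun U _ => ?_
    rw [Finset.prod_product, Finset.prod_const_one]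
    ring
  rw [Finset.sum_filter, Finset.sum_congr rfl fun x _ => (hind x).trans (hexp x),
    Finset.sum_comm, Finset.prod_sub]
  refine Finset.sum_congr rfl fun U _ => ?_
  rw [← Finset.mul_sum, sum_prod_mul_prod_ite_eq w hw e he (fun q => f q.2),
    Finset.prod_product, Finset.prod_const_one, mul_one]

end Weights

universe u v w x

/-! ### Probabilities of events -/

section Events

variable {τ : Vocabulary.{u}} [Fintype τ.Symb] {A : Type v} {M : Type w} [Fintype M]

theorem modelProb_nonneg {p : τ.Symb → A → ℝ} (hp : ∀ R a, 0 < p R a) (𝔐 : Model τ A M) :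
    0 ≤ modelProb p 𝔐 :=
  Finset.prod_nonneg fun _ _ => Finset.prod_nonneg fun _ _ => (hp _ _).le

-- Uncurrying puts all atomic statements into one index set, where the product weight lemmas apply.
open Classical in
theorem modelProb_eq_prod_sigma (p : τ.Symb → A → ℝ)
    (y : (Σ R : τ.Symb, Fin (τ.arity R) → M) → A) :
    modelProb p (fun R i => y ⟨R, i⟩ : Model τ A M) = ∏ t, p t.1 (y t) := by
  rw [Fintype.prod_sigma]
  rfl

variable [Fintype A]

/-- The probability that a random structure with domain `M` has the property `P`. -/
noncomputable def eventProb (p : τ.Symb → A → ℝ) (P : Model τ A M → Prop) : ℝ :=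
  open Classical in ∑ 𝔐 : Model τ A M with P 𝔐, modelProb p 𝔐

open Classical in
theorem eventProb_eq_sum_sigma (p : τ.Symb → A → ℝ) (P : Model τ A M → Prop) :
    eventProb p P = ∑ y : (Σ R : τ.Symb, Fin (τ.arity R) → M) → A with P (fun R i => y ⟨R, i⟩),
      ∏ t, p t.1 (y t) := by
  unfold eventProb
  rw [Finset.sum_filter, Finset.sum_filter]
  symm
  refine Fintype.sum_equiv (Equiv.piCurry fun _ _ => A) _ _ fun y => ?_
  rw [← modelProb_eq_prod_sigma]
  rfl

theorem eventProb_mono {p : τ.Symb → A → ℝ} (hp : ∀ R a, 0 < p R a)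
    {P Q : Model τ A M → Prop} (h : ∀ 𝔐, P 𝔐 → Q 𝔐) : eventProb p P ≤ eventProb p Q := by
  classical
  exact Finset.sum_le_sum_of_subset_of_nonneg (Finset.monotone_filter_right _ fun 𝔐 _ => h 𝔐)
    fun 𝔐 _ _ => modelProb_nonneg hp 𝔐

theorem eventProb_nonneg {p : τ.Symb → A → ℝ} (hp : ∀ R a, 0 < p R a)
    (P : Model τ A M → Prop) : 0 ≤ eventProb p P :=
  Finset.sum_nonneg fun 𝔐 _ => modelProb_nonneg hp 𝔐

theorem eventProb_eq_zero (p : τ.Symb → A → ℝ) {P : Model τ A M → Prop} (h : ∀ 𝔐, ¬ P 𝔐) :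
    eventProb p P = 0 := by
  simp [eventProb, h]

theorem eventProb_exists_le {p : τ.Symb → A → ℝ} (hp : ∀ R a, 0 < p R a) {J : Type*} [Fintype J]
    (P : J → Model τ A M → Prop) :
    eventProb p (fun 𝔐 => ∃ j, P j 𝔐) ≤ ∑ j, eventProb p (P j) := by
  classical
  simp only [eventProb, Finset.sum_filter]
  rw [Finset.sum_comm]
  refine Finset.sum_le_sum fun 𝔐 _ => ?_
  have h0 : ∀ j, 0 ≤ if P j 𝔐 then modelProb p 𝔐 else 0 := fun j => by
    split_ifs
    exacts [modelProb_nonneg hp 𝔐, le_rfl]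
  split_ifs with h
  · obtain ⟨j, hj⟩ := h
    exact (if_pos hj).symm.le.trans
      (Finset.single_le_sum (fun j _ => h0 j) (Finset.mem_univ j))
  · exact Finset.sum_nonneg fun j _ => h0 j

theorem eventProb_true {p : τ.Symb → A → ℝ} (hp : ∀ R, ∑ a, p R a = 1) :
    eventProb p (fun _ : Model τ A M => True) = 1 := by
  classical
  -- With `U = ∅` the pattern is irrelevant; `A` is nonempty as soon as some `q` exists, because `p
  -- q.1` sums to 1.
  have := sum_prod_mul_prod_ite_eq (fun t : Σ R : τ.Symb, Fin (τ.arity R) → M => p t.1)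
    (fun t => hp t.1) id Function.injective_id (fun q => (Classical.choice ?_ : A)) ∅
  · rw [eventProb_eq_sum_sigma]
    simpa using this
  · by_contra h
    rw [not_nonempty_iff] at h
    simpa using hp q.1

theorem eventProb_not {p : τ.Symb → A → ℝ} (hp : ∀ R, ∑ a, p R a = 1)
    (P : Model τ A M → Prop) : eventProb p (fun 𝔐 => ¬ P 𝔐) = 1 - eventProb p P := by
  classical
  rw [← eventProb_true (M := M) hp, eq_sub_iff_add_eq']
  simp only [eventProb, Finset.filter_true]
  exact Finset.sum_filter_add_sum_filter_not _ _ _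

end Events

/-! ### Extension properties -/

/-- The atomic formulas in `k + 1` variables in which the last variable occurs. -/
abbrev LastAtom (τ : Vocabulary.{u}) (k : ℕ) : Type u :=
  Σ R : τ.Symb, {xs : Fin (τ.arity R) → Fin (k + 1) // ∃ s, xs s = Fin.last k}

/-- Every assignment of values to the new atomic formulas over a tuple of `k` distinct elements is
realised by a new element. -/
def HasExtensions {τ : Vocabulary.{u}} {A : Type v} {M : Type w} (k : ℕ) (𝔐 : Model τ A M) :
    Prop :=
  ∀ (j : Fin k ↪ M) (f : LastAtom τ k → A), ∃ m : {m : M // m ∉ Set.range j},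
    ∀ d : LastAtom τ k, 𝔐 d.1 (fun s => (Fin.snoc j m.1 : Fin (k + 1) → M) (d.2.1 s)) = f d

section Extensions

variable {τ : Vocabulary.{u}} {A : Type v} {M : Type w}

/-- The new atomic statements obtained by adding a new element to a tuple are pairwise
distinct. -/
theorem injective_newAtoms {k : ℕ} (j : Fin k ↪ M) :
    Function.Injective fun q : {m : M // m ∉ Set.range j} × LastAtom τ k =>
      (⟨q.2.1, fun s => (Fin.snoc j q.1.1 : Fin (k + 1) → M) (q.2.2.1 s)⟩ :
        Σ R : τ.Symb, Fin (τ.arity R) → M) := by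
  rintro ⟨⟨m, hm⟩, ⟨R, xs, s, hs⟩⟩ ⟨⟨m', hm'⟩, ⟨R', xs', s', hs'⟩⟩ h
  obtain ⟨rfl, h⟩ := Sigma.mk.inj_iff.1 h
  have h := fun s => congrFun (eq_of_heq h) s
  dsimp only at h
  -- The last variable occurs in `xs`, so `m` is an argument of both atoms; it lies outside the
  -- range of `j`, so it must be `m'`.
  have hmm : m = m' := by
    have := h s
    rw [hs, Fin.snoc_last] at this
    induction hx : xs' s using Fin.lastCases with
    | last => simpa [hx] using this
    | cast l =>
      rw [hx, Fin.snoc_castSucc] at this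
      exact absurd ⟨l, this.symm⟩ hm
  subst hmm
  have hinj : Function.Injective (Fin.snoc j m : Fin (k + 1) → M) :=
    Fin.snoc_injective_of_injective j.injective hm
  obtain rfl : xs = xs' := funext fun s => hinj (h s)
  rfl

variable [Fintype τ.Symb] [Fintype A] [Fintype M]

-- A union bound over tuples `j` and patterns `f`; for each pair the failure probability is an exact
-- product over the candidates.
open Classical in
theorem eventProb_not_hasExtensions_le {p : τ.Symb → A → ℝ} (hp : ∀ R a, 0 < p R a)
    (hp1 : ∀ R, ∑ a, p R a = 1) {c : ℝ} (hc0 : 0 < c) (hc1 : c ≤ 1) (hc : ∀ R a, c ≤ p R a)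
    (k : ℕ) :
    eventProb p (fun 𝔐 : Model τ A M => ¬ HasExtensions k 𝔐) ≤
      (Fintype.card M : ℝ) ^ k * Fintype.card (LastAtom τ k → A) *
        (1 - c ^ Fintype.card (LastAtom τ k)) ^ (Fintype.card M - k) := by
  have hone : ∀ (j : Fin k ↪ M) (f : LastAtom τ k → A),
      eventProb p (fun 𝔐 : Model τ A M => ∀ m : {m : M // m ∉ Set.range j},
        ∃ d : LastAtom τ k,
          𝔐 d.1 (fun s => (Fin.snoc j m.1 : Fin (k + 1) → M) (d.2.1 s)) ≠ f d) ≤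
        (1 - c ^ Fintype.card (LastAtom τ k)) ^ (Fintype.card M - k) := by
    intro j f
    rw [eventProb_eq_sum_sigma, sum_prod_filter_forall_exists_ne (fun t => p t.1)
      (fun t => hp1 t.1) _ (injective_newAtoms j) f _ ?hpattern]
    case hpattern => exact fun _ => Iff.rfl
    have hcard : Fintype.card {m : M // m ∉ Set.range j} = Fintype.card M - k := by
      rw [Fintype.card_subtype_compl]
      congr 1
      exact (Fintype.card_congr (Equiv.ofInjective j j.injective)).symm.trans (Fintype.card_fin k)
    have hp_le : ∀ R a, p R a ≤ 1 := fun R a =>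
      (hp1 R).symm ▸ Finset.single_le_sum (fun b _ => (hp R b).le) (Finset.mem_univ a)
    rw [← hcard, ← Finset.card_univ (α := {m : M // m ∉ Set.range j})]
    rw [← Finset.prod_const]
    refine Finset.prod_le_prod (fun m _ => sub_nonneg.2 (Finset.prod_le_one
      (fun d _ => (hp _ _).le) fun d _ => hp_le _ _)) fun m _ => sub_le_sub_left ?_ 1
    rw [← Finset.card_univ (α := LastAtom τ k), ← Finset.prod_const]
    exact Finset.prod_le_prod (fun d _ => hc0.le) fun d _ => hc _ _
  have hunion : eventProb p (fun 𝔐 : Model τ A M => ¬ HasExtensions k 𝔐) ≤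
      ∑ _ : (Fin k ↪ M) × (LastAtom τ k → A),
        (1 - c ^ Fintype.card (LastAtom τ k)) ^ (Fintype.card M - k) := by
    refine (eventProb_mono hp fun 𝔐 h => ?_).trans ((eventProb_exists_le hp
      fun (q : (Fin k ↪ M) × (LastAtom τ k → A)) (𝔐 : Model τ A M) =>
        ∀ m : {m : M // m ∉ Set.range q.1}, ∃ d : LastAtom τ k,
          𝔐 d.1 (fun s => (Fin.snoc q.1 m.1 : Fin (k + 1) → M) (d.2.1 s)) ≠ q.2 d).trans
      (Finset.sum_le_sum fun q _ => hone q.1 q.2))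
    unfold HasExtensions at h
    push Not at h
    obtain ⟨j, f, h⟩ := h
    exact ⟨(j, f), h⟩
  refine hunion.trans ?_
  have hb : (0 : ℝ) ≤ (1 - c ^ Fintype.card (LastAtom τ k)) ^ (Fintype.card M - k) :=
    pow_nonneg (sub_nonneg.2 (pow_le_one₀ hc0.le hc1)) _
  rw [Finset.sum_const, nsmul_eq_mul, Finset.card_univ, Fintype.card_prod, Nat.cast_mul]
  gcongr
  rw [Fintype.card_embedding_eq, Fintype.card_fin]
  exact_mod_cast Nat.descFactorial_le_pow _ _

theorem tendsto_eventProb_not_hasExtensions {p : τ.Symb → A → ℝ} (hp : ∀ R a, 0 < p R a)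
    (hp1 : ∀ R, ∑ a, p R a = 1) (k : ℕ) :
    Tendsto (fun n => eventProb p (fun 𝔐 : Model τ A (Fin (n + 1)) => ¬ HasExtensions k 𝔐))
      atTop (𝓝 0) := by
  classical
  obtain ⟨c, hc0, hc1, hc⟩ : ∃ c : ℝ, 0 < c ∧ c ≤ 1 ∧ ∀ R a, c ≤ p R a := by
    -- The entry `none`, with value 1, forces `c ≤ 1` even if `τ` has no symbols.
    obtain ⟨c, hc⟩ := Finite.exists_ge
      (fun q : Option (τ.Symb × A) => (q.elim ⟨1, one_pos⟩ fun q => ⟨p q.1 q.2, hp _ _⟩ :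
        {x : ℝ // 0 < x}))
    exact ⟨c.1, c.2, hc none, fun R a => hc (some (R, a))⟩
  -- The base may be 0, for instance when there are no new atoms; the maximum with `1 / 2` permits
  -- division by `r ^ k`.
  set r : ℝ := max (1 - c ^ Fintype.card (LastAtom τ k)) (1 / 2) with hr
  have hr0 : 0 < r := lt_max_of_lt_right (by norm_num)
  have hr1 : r < 1 := max_lt (sub_lt_self _ (pow_pos hc0 _)) (by norm_num)
  have hlim : Tendsto (fun n : ℕ => (((n + 1 : ℕ) : ℝ) ^ k * r ^ (n + 1)) *
      (Fintype.card (LastAtom τ k → A) / r ^ k)) atTop (𝓝 0) := by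
    have := ((tendsto_pow_const_mul_const_pow_of_lt_one k hr0.le hr1).comp
      (tendsto_add_atTop_nat 1)).mul_const ((Fintype.card (LastAtom τ k → A) : ℝ) / r ^ k)
    simpa using this
  refine squeeze_zero (fun n => eventProb_nonneg hp _) (fun n => ?_) hlim
  refine (eventProb_not_hasExtensions_le hp hp1 hc0 hc1 hc k).trans ?_
  rw [Fintype.card_fin]
  have hpow : (1 - c ^ Fintype.card (LastAtom τ k)) ^ (n + 1 - k) ≤ r ^ (n + 1) / r ^ k := by
    rw [le_div_iff₀ (pow_pos hr0 k)]
    calc _ ≤ r ^ (n + 1 - k) * r ^ k := by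
          gcongr
          · exact sub_nonneg.2 (pow_le_one₀ hc0.le hc1)
          · exact le_max_left _ _
      _ = r ^ (n + 1 - k + k) := (pow_add _ _ _).symm
      -- Only an inequality, since the subtraction truncates when `k > n + 1`.
      _ ≤ r ^ (n + 1) := pow_le_pow_of_le_one hr0.le hr1.le (by omega)
  calc _ ≤ ((n + 1 : ℕ) : ℝ) ^ k * Fintype.card (LastAtom τ k → A) * (r ^ (n + 1) / r ^ k) := by
        gcongr
    _ = _ := by ring

theorem tendsto_eventProb_forall_hasExtensions {p : τ.Symb → A → ℝ} (hp : ∀ R a, 0 < p R a)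
    (hp1 : ∀ R, ∑ a, p R a = 1) (K : ℕ) :
    Tendsto (fun n => eventProb p
      (fun 𝔐 : Model τ A (Fin (n + 1)) => ∀ k : Fin K, HasExtensions k 𝔐)) atTop (𝓝 1) := by
  have hsum : Tendsto (fun n => ∑ k : Fin K,
      eventProb p (fun 𝔐 : Model τ A (Fin (n + 1)) => ¬ HasExtensions k 𝔐)) atTop (𝓝 0) := by
    simpa using tendsto_finsetSum (Finset.univ : Finset (Fin K)) fun k _ =>
      tendsto_eventProb_not_hasExtensions hp hp1 (k : ℕ)
  have hnot : Tendsto (fun n => eventProb p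
      (fun 𝔐 : Model τ A (Fin (n + 1)) => ¬ ∀ k : Fin K, HasExtensions k 𝔐)) atTop (𝓝 0) :=
    squeeze_zero (fun n => eventProb_nonneg hp _)
      (fun n => (eventProb_mono hp fun 𝔐 h => not_forall.1 h).trans
        (eventProb_exists_le hp fun (k : Fin K) (𝔐 : Model τ A (Fin (n + 1))) =>
          ¬ HasExtensions k 𝔐)) hsum
  simpa only [eventProb_not hp1, sub_sub_cancel, sub_zero] using hnot.const_sub 1

end Extensions

/-! ### Back and forth -/

section BackAndForth

variable {σ : Vocabulary.{u}} {τ : Vocabulary.{v}} {A : Type w}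

/-- Two tuples satisfy the same atomic formulas to the same degree. -/
def SameType {M N : Type*} (𝔐 : Model τ A M) (𝔑 : Model τ A N) {l : ℕ} (i : Fin l → M)
    (j : Fin l → N) : Prop :=
  ∀ (R : τ.Symb) (xs : Fin (τ.arity R) → Fin l),
    𝔐 R (fun s => i (xs s)) = 𝔑 R (fun s => j (xs s))

theorem SameType.symm {M N : Type*} {𝔐 : Model τ A M} {𝔑 : Model τ A N} {l : ℕ} {i : Fin l → M}
    {j : Fin l → N} (h : SameType 𝔐 𝔑 i j) : SameType 𝔑 𝔐 j i :=
  fun R xs => (h R xs).symm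

/-- The extension property copies the values of the atoms that involve `m`; the remaining atoms are
covered by `h`. Taking `n` outside the range of `j` keeps the tuple injective. -/
theorem SameType.exists_extension {M N : Type*} {𝔐 : Model τ A M} {𝔑 : Model τ A N} {l : ℕ}
    {i : Fin l → M} {j : Fin l ↪ N} (h : SameType 𝔐 𝔑 i j) (hN : HasExtensions l 𝔑) (m : M) :
    ∃ n, n ∉ Set.range j ∧
      SameType 𝔐 𝔑 (Fin.snoc i m : Fin (l + 1) → M) (Fin.snoc j n : Fin (l + 1) → N) := by
  obtain ⟨⟨n, hn⟩, hf⟩ := hN j fun d =>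
    𝔐 d.1 (fun s => (Fin.snoc i m : Fin (l + 1) → M) (d.2.1 s))
  refine ⟨n, hn, fun R xs => ?_⟩
  by_cases hlast : ∃ s, xs s = Fin.last l
  · exact (hf ⟨R, xs, hlast⟩).symm
  · push Not at hlast
    choose ys hys using fun s => Fin.exists_castSucc_eq.2 (hlast s)
    simpa only [← hys, Fin.snoc_castSucc] using h R ys

variable [Lattice A] (op : Operations σ A)

/-- The values of `φ` at tuples of length `l` of distinct elements, with variables substituted
according to `g`, depend only on the atomic type of the tuple, in all structures with extensions
below `K`. -/
def DeterminedBelow (K : ℕ) {k l : ℕ} (φ : Formula σ τ k) (g : Fin k → Fin l) : Prop :=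
  ∀ (M N : Type x) [Fintype M] [Nonempty M] [Fintype N] [Nonempty N]
    (𝔐 : Model τ A M) (𝔑 : Model τ A N),
    (∀ k < K, HasExtensions k 𝔐) → (∀ k < K, HasExtensions k 𝔑) →
    ∀ (i : Fin l ↪ M) (j : Fin l ↪ N), SameType 𝔐 𝔑 i j →
      φ.value op 𝔐 (i ∘ g) = φ.value op 𝔑 (j ∘ g)

variable {op}

theorem DeterminedBelow.mono {K K' : ℕ} (hK : K ≤ K') {k l : ℕ} {φ : Formula σ τ k}
    {g : Fin k → Fin l} (h : DeterminedBelow.{u, v, w, x} op K φ g) :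
    DeterminedBelow.{u, v, w, x} op K' φ g :=
  fun M N _ _ _ _ 𝔐 𝔑 hM hN i j hij => h M N 𝔐 𝔑 (fun k hk => hM k (hk.trans_le hK))
    (fun k hk => hN k (hk.trans_le hK)) i j hij

/-- The step for quantifiers: every value of `φ` at an extension of a tuple is also a value of `φ`
at an extension of a tuple of the same type. -/
theorem DeterminedBelow.exists_value_eq {K k l : ℕ} {φ : Formula σ τ (k + 1)} {g : Fin k → Fin l}
    (hold : ∀ t : Fin l, DeterminedBelow.{u, v, w, x} op K φ (Fin.snoc g t : Fin (k + 1) → Fin l))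
    (hnew : DeterminedBelow.{u, v, w, x} op K φ
      (Fin.snoc (Fin.castSucc ∘ g) (Fin.last l) : Fin (k + 1) → Fin (l + 1)))
    (hl : l < K) {M N : Type x} [Fintype M] [Nonempty M] [Fintype N] [Nonempty N]
    {𝔐 : Model τ A M} {𝔑 : Model τ A N}
    (hM : ∀ k < K, HasExtensions k 𝔐) (hN : ∀ k < K, HasExtensions k 𝔑)
    {i : Fin l ↪ M} {j : Fin l ↪ N} (hij : SameType 𝔐 𝔑 i j) (m : M) :
    ∃ n, φ.value op 𝔐 (Fin.snoc (i ∘ g) m : Fin (k + 1) → M)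
      = φ.value op 𝔑 (Fin.snoc (j ∘ g) n : Fin (k + 1) → N) := by
  by_cases hm : m ∈ Set.range i
  · obtain ⟨t, rfl⟩ := hm
    refine ⟨j t, ?_⟩
    have := hold t M N 𝔐 𝔑 hM hN i j hij
    rwa [Fin.comp_snoc, Fin.comp_snoc] at this
  · obtain ⟨n, hn, h⟩ := hij.exists_extension (hN l hl) m
    refine ⟨n, ?_⟩
    have := hnew M N 𝔐 𝔑 hM hN ⟨_, Fin.snoc_injective_of_injective i.injective hm⟩
      ⟨_, Fin.snoc_injective_of_injective j.injective hn⟩ h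
    simpa only [Function.Embedding.coeFn_mk, Fin.comp_snoc, ← Function.comp_assoc,
      Fin.snoc_comp_castSucc, Fin.snoc_last] using this

variable (op)

/-- The induction keeps `l` and `g` general because a quantified element either repeats an entry of
the tuple, which changes `g`, or is new, which increases `l`. -/
theorem exists_determinedBelow {k : ℕ} (φ : Formula σ τ k) :
    ∀ {l : ℕ} (g : Fin k → Fin l), ∃ K, DeterminedBelow.{u, v, w, x} op K φ g := by
  have hquant : ∀ {k : ℕ} (φ : Formula σ τ (k + 1)),
      (∀ {l : ℕ} (g : Fin (k + 1) → Fin l), ∃ K, DeterminedBelow.{u, v, w, x} op K φ g) →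
      ∀ {l : ℕ} (g : Fin k → Fin l), ∃ K,
        (∀ t : Fin l, DeterminedBelow.{u, v, w, x} op K φ (Fin.snoc g t : Fin (k + 1) → Fin l)) ∧
        DeterminedBelow.{u, v, w, x} op K φ
          (Fin.snoc (Fin.castSucc ∘ g) (Fin.last l) : Fin (k + 1) → Fin (l + 1)) ∧ l < K := by
    intro k φ ih l g
    choose K hK using fun t : Fin l => ih (Fin.snoc g t : Fin (k + 1) → Fin l)
    obtain ⟨K', hK'⟩ := ih (Fin.snoc (Fin.castSucc ∘ g) (Fin.last l) : Fin (k + 1) → Fin (l + 1))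
    -- This dominates the bounds for all repeated entries and for a new one, and exceeds `l`, so
    -- that `l`-tuples can be extended.
    refine ⟨Finset.univ.sup K + K' + l + 1, fun t => (hK t).mono ?_, hK'.mono ?_, ?_⟩
    · have := Finset.le_sup (f := K) (Finset.mem_univ t)
      omega
    · omega
    · omega
  induction φ with
  | rel R xs =>
    intro l g
    exact ⟨0, fun M N _ _ _ _ 𝔐 𝔑 _ _ i j hij => hij R (fun s => g (xs s))⟩
  | and φ ψ ihφ ihψ =>
    intro l g
    obtain ⟨K, hK⟩ := ihφ g
    obtain ⟨K', hK'⟩ := ihψ g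
    exact ⟨max K K', fun M N _ _ _ _ 𝔐 𝔑 hM hN i j hij => congrArg₂ _
      (hK.mono (le_max_left _ _) M N 𝔐 𝔑 hM hN i j hij)
      (hK'.mono (le_max_right _ _) M N 𝔐 𝔑 hM hN i j hij)⟩
  | or φ ψ ihφ ihψ =>
    intro l g
    obtain ⟨K, hK⟩ := ihφ g
    obtain ⟨K', hK'⟩ := ihψ g
    exact ⟨max K K', fun M N _ _ _ _ 𝔐 𝔑 hM hN i j hij => congrArg₂ _
      (hK.mono (le_max_left _ _) M N 𝔐 𝔑 hM hN i j hij)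
      (hK'.mono (le_max_right _ _) M N 𝔐 𝔑 hM hN i j hij)⟩
  | conn c φs ih =>
    intro l g
    choose K hK using fun s => ih s g
    exact ⟨Finset.univ.sup K, fun M N _ _ _ _ 𝔐 𝔑 hM hN i j hij => congrArg (op c) <|
      funext fun s => (hK s).mono (Finset.le_sup (Finset.mem_univ s)) M N 𝔐 𝔑 hM hN i j hij⟩
  | all φ ih =>
    intro l g
    obtain ⟨K, hold, hnew, hl⟩ := hquant φ ih g
    refine ⟨K, fun M N _ _ _ _ 𝔐 𝔑 hM hN i j hij => le_antisymm ?_ ?_⟩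
    · refine Finset.le_inf' _ _ fun n _ => ?_
      obtain ⟨m, hm⟩ := DeterminedBelow.exists_value_eq hold hnew hl hN hM hij.symm n
      exact hm ▸ Finset.inf'_le _ (Finset.mem_univ m)
    · refine Finset.le_inf' _ _ fun m _ => ?_
      obtain ⟨n, hn⟩ := DeterminedBelow.exists_value_eq hold hnew hl hM hN hij m
      exact hn ▸ Finset.inf'_le _ (Finset.mem_univ n)
  | ex φ ih =>
    intro l g
    obtain ⟨K, hold, hnew, hl⟩ := hquant φ ih g
    refine ⟨K, fun M N _ _ _ _ 𝔐 𝔑 hM hN i j hij => le_antisymm ?_ ?_⟩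
    · refine Finset.sup'_le _ _ fun m _ => ?_
      obtain ⟨n, hn⟩ := DeterminedBelow.exists_value_eq hold hnew hl hM hN hij m
      exact hn.trans_le (Finset.le_sup' (fun n => φ.value op 𝔑 (Fin.snoc (j ∘ g) n))
        (Finset.mem_univ n))
    · refine Finset.sup'_le _ _ fun n _ => ?_
      obtain ⟨m, hm⟩ := DeterminedBelow.exists_value_eq hold hnew hl hN hM hij.symm n
      exact hm.trans_le (Finset.le_sup' (fun m => φ.value op 𝔐 (Fin.snoc (i ∘ g) m))
        (Finset.mem_univ m))

/-- A sentence has the same value in all structures with sufficiently many extensions. -/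
theorem exists_value_eq_of_hasExtensions (hτ : ∀ R : τ.Symb, 0 < τ.arity R) (φ : Sentence σ τ) :
    ∃ K, ∀ (M N : Type x) [Fintype M] [Nonempty M] [Fintype N] [Nonempty N]
      (𝔐 : Model τ A M) (𝔑 : Model τ A N),
      (∀ k < K, HasExtensions k 𝔐) → (∀ k < K, HasExtensions k 𝔑) →
      φ.value op 𝔐 Fin.elim0 = φ.value op 𝔑 Fin.elim0 := by
  obtain ⟨K, hK⟩ := exists_determinedBelow.{u, v, w, x} op φ (Fin.elim0 : Fin 0 → Fin 0)
  refine ⟨K, fun M N _ _ _ _ 𝔐 𝔑 hM hN => ?_⟩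
  have := hK M N 𝔐 𝔑 hM hN ⟨Fin.elim0, fun a => a.elim0⟩ ⟨Fin.elim0, fun a => a.elim0⟩
    -- Positive arity makes agreement on atoms vacuous for the empty tuple.
    fun R xs => (xs ⟨0, hτ R⟩).elim0
  convert this using 2

end BackAndForth

end ManyValued

/-! ### The zero-one law -/

theorem mainTheorem1
    {σ : ManyValued.Vocabulary} {τ : ManyValued.Vocabulary} [Fintype τ.Symb]
    (hτ : ∀ R : τ.Symb, 0 < τ.arity R)
    {A : Type*} [Lattice A] [Fintype A] (op : ManyValued.Operations σ A)
    (p : τ.Symb → A → ℝ) (hp_pos : ∀ R a, 0 < p R a) (hp_sum : ∀ R, ∑ a, p R a = 1)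
    (φ : ManyValued.Sentence σ τ) :
    (∀ a : A, Tendsto (ManyValued.sentenceProb op p φ a) atTop (𝓝 1) ∨
        Tendsto (ManyValued.sentenceProb op p φ a) atTop (𝓝 0)) ∧
      ∃! a : A, Tendsto (ManyValued.sentenceProb op p φ a) atTop (𝓝 1) := by
  open ManyValued in
  have hprob : ∀ a n, sentenceProb op p φ a n = eventProb p
      (fun 𝔐 : Model τ A (Fin (n + 1)) => φ.value op 𝔐 Fin.elim0 = a) := fun _ _ => rfl
  obtain ⟨K, hK⟩ := exists_value_eq_of_hasExtensions op hτ φ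
  have hext := tendsto_eventProb_forall_hasExtensions hp_pos hp_sum K
  -- The almost sure value is read off from one structure with extensions; if there were none,
  -- probabilities tending to 1 would all be 0.
  obtain ⟨n₀, 𝔐₀, h₀⟩ : ∃ (n : ℕ) (𝔐 : Model τ A (Fin (n + 1))),
      ∀ k : Fin K, HasExtensions k 𝔐 := by
    by_contra! h
    refine one_ne_zero (tendsto_nhds_unique hext ?_)
    exact tendsto_const_nhds.congr fun n =>
      (eventProb_eq_zero p fun 𝔐 => not_forall.2 (h n 𝔐)).symm
  have hone : Tendsto (sentenceProb op p φ (φ.value op 𝔐₀ Fin.elim0)) atTop (𝓝 1) := by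
    refine tendsto_of_tendsto_of_tendsto_of_le_of_le hext tendsto_const_nhds (fun n => ?_)
      fun n => ?_
    · rw [hprob]
      exact eventProb_mono hp_pos fun 𝔐 h𝔐 => hK _ _ 𝔐 𝔐₀ (fun k hk => h𝔐 ⟨k, hk⟩)
        fun k hk => h₀ ⟨k, hk⟩
    · rw [hprob, ← eventProb_true (M := Fin (n + 1)) hp_sum]
      exact eventProb_mono hp_pos fun _ _ => trivial
  have hzero : ∀ a, a ≠ φ.value op 𝔐₀ Fin.elim0 →
      Tendsto (sentenceProb op p φ a) atTop (𝓝 0) := by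
    intro a ha
    have hcompl := hone.const_sub 1
    rw [sub_self] at hcompl
    refine squeeze_zero (fun n => ?_) (fun n => ?_) hcompl
    · rw [hprob]
      exact eventProb_nonneg hp_pos _
    · rw [hprob, hprob, ← eventProb_not hp_sum]
      exact eventProb_mono hp_pos fun 𝔐 h𝔐 h => ha (h𝔐.symm.trans h)
  refine ⟨fun a => ?_, _, hone, fun a ha => ?_⟩
  · by_cases h : a = φ.value op 𝔐₀ Fin.elim0
    · exact Or.inl (h ▸ hone)
    · exact Or.inr (hzero a h)
  · by_contra h
    exact one_ne_zero (tendsto_nhds_unique ha (hzero a h))
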